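/- Let $\mathcal X,\mathcal U,\mathcal Y$ be complex Hilbert spaces. Let $H^2(\mathcal Y)$ be the Hardy space of $\mathcal Y$-valued functions $f(z)=\sum_{n\ge 0}f_nz^n$ on the open unit disk $\mathbb D$ with $\|f\|^2=\sum_{n\ge0}\|f_n\|^2<\infty$, and define $H^2(\mathcal U)$ likewise. Let $\mathcal S(\mathcal U,\mathcal Y)$ be the Schur class of functions analytic on $\mathbb D$ whose values are contractions in $\mathcal L(\mathcal U,\mathcal Y)$. For $S\in\mathcal S(\mathcal U,\mathcal Y)$ let $T_S:H^2(\mathcal U)\to H^2(\mathcal Y)$, $f\mapsto Sf$, be the (contractive) operator of multiplication by $S$. Let $T\in\mathcal L(\mathcal X)$, $E\in\mathcal L(\mathcal X,\mathcal Y)$ and $N\in\mathcal L(\mathcal X,\mathcal U)$ be bounded linear operators such that the pairs $(E,T)$ and $(N,T)$ are output stable, i.e. such that for every $x\in\mathcal X$ the power series $$\mathcal O_{E,T}x:=E(I-zT)^{-1}x=\sum_{n\ge0}z^nET^nx,\qquad \mathcal O_{N,T}x:=N(I-zT)^{-1}x=\sum_{n\ge0}z^nNT^nx$$ belong to $H^2(\mathcal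 Y)$ and $H^2(\mathcal U)$, respectively. The linear operators $\mathcal O_{E,T}:\mathcal X\to H^2(\mathcal Y)$ and $\mathcal O_{N,T}:\mathcal X\to H^2(\mathcal U)$ so defined are automatically bounded. **Theorem.** There exists a function $S\in\mathcal S(\mathcal U,\mathcal Y)$ with $$T_S^*\,\mathcal O_{E,T}=\mathcal O_{N,T}$$ if and only if the Pick operator $$P:=\mathcal O_{E,T}^*\mathcal O_{E,T}-\mathcal O_{N,T}^*\mathcal O_{N,T}$$ is positive semidefinite. -/

import Mathlib

open scoped InnerProductSpace

noncomputable section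

/-- The Hardy space `H²(𝒴)` of the unit disk: a function `f(z) = ∑ zⁿ fₙ` with square-summable
Taylor coefficients is represented by its coefficient sequence, and
`‖f‖² = ∑ ‖fₙ‖²`.  The function itself is `HardySpace.eval f`. -/
abbrev HardySpace (Y : Type*) [NormedAddCommGroup Y] : Type _ :=
  lp (fun _ : ℕ => Y) 2

/-- The value at the point `z` of the disk of a function in `H²(𝒴)`. -/
def HardySpace.eval {Y : Type*} [NormedAddCommGroup Y] [InnerProductSpace ℂ Y]
    (f : HardySpace Y) (z : ℂ) : Y :=
  ∑' n : ℕ, z ^ n • f n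

/-- The Schur class `𝒮(𝒰, 𝒴)`: functions analytic on the open unit disk whose values there are
contractive operators.  (Values outside the disk are irrelevant.) -/
structure IsSchur {U Y : Type*} [NormedAddCommGroup U] [InnerProductSpace ℂ U]
    [NormedAddCommGroup Y] [InnerProductSpace ℂ Y] (S : ℂ → U →L[ℂ] Y) : Prop where
  differentiableOn : DifferentiableOn ℂ S (Metric.ball 0 1)
  norm_le_one : ∀ z ∈ Metric.ball (0 : ℂ) 1, ‖S z‖ ≤ 1

section HardyFacts

variable {Y : Type*} [NormedAddCommGroup Y] [InnerProductSpace ℂ Y]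

theorem HardySpace.norm_term_le (f : HardySpace Y) (z : ℂ) (n : ℕ) :
    ‖z ^ n • f n‖ ≤ ‖f‖ * ‖z‖ ^ n := by
  rw [norm_smul, norm_pow, mul_comm]
  gcongr
  exact lp.norm_apply_le_norm two_ne_zero f n

theorem HardySpace.summable_norm (f : HardySpace Y) {z : ℂ} (hz : ‖z‖ < 1) :
    Summable fun n : ℕ => ‖z ^ n • f n‖ :=
  Summable.of_nonneg_of_le (fun _ => norm_nonneg _) (f.norm_term_le z)
    ((summable_geometric_of_lt_one (norm_nonneg z) hz).mul_left _)

variable [CompleteSpace Y]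

theorem HardySpace.hasSum_eval (f : HardySpace Y) {z : ℂ} (hz : ‖z‖ < 1) :
    HasSum (fun n : ℕ => z ^ n • f n) (f.eval z) :=
  (f.summable_norm hz).of_norm.hasSum

theorem HardySpace.differentiableOn_eval (f : HardySpace Y) :
    DifferentiableOn ℂ f.eval (Metric.ball 0 1) := by
  intro z hz
  rw [mem_ball_zero_iff] at hz
  obtain ⟨r, hzr, hr⟩ := exists_between hz
  have hr0 : 0 ≤ r := (norm_nonneg z).trans hzr.le
  have h : DifferentiableOn ℂ f.eval (Metric.ball 0 r) := by
    refine Complex.differentiableOn_tsum_of_summable_norm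
      (u := fun n : ℕ => ‖f‖ * r ^ n) ((summable_geometric_of_lt_one hr0 hr).mul_left _)
      (fun n => ?_) Metric.isOpen_ball (fun n w hw => ?_)
    · exact ((differentiable_id.pow n).smul_const _).differentiableOn
    · refine (f.norm_term_le w n).trans ?_
      rw [mem_ball_zero_iff] at hw
      gcongr
  exact ((h z (by simpa using hzr)).differentiableAt
    (Metric.isOpen_ball.mem_nhds (by simpa using hzr))).differentiableWithinAt

/-- Parseval's identity on the unit circle for absolutely convergent vector Fourier series. -/
theorem hardy_parseval (b : ℕ → Y) (hb : Summable fun n => ‖b n‖) (h : ℝ → Y)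
    (hh : ∀ t : ℝ, HasSum (fun n : ℕ => (Complex.exp (t * Complex.I)) ^ n • b n) (h t)) :
    Continuous h ∧
      HasSum (fun n => 2 * Real.pi * ‖b n‖ ^ 2) (∫ t in (0 : ℝ)..(2 * Real.pi), ‖h t‖ ^ 2) := by
  have hnorm : ∀ (t : ℝ) (n : ℕ), ‖(Complex.exp (t * Complex.I)) ^ n‖ = 1 := fun t n => by
    rw [norm_pow, Complex.norm_exp_ofReal_mul_I, one_pow]
  have hcont : Continuous h := by
    have : h = fun t : ℝ => ∑' n : ℕ, (Complex.exp (t * Complex.I)) ^ n • b n :=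
      funext fun t => (hh t).tsum_eq.symm
    rw [this]
    refine continuous_tsum (fun n => by fun_prop) hb (fun n t => ?_)
    rw [norm_smul, hnorm, one_mul]
  refine ⟨hcont, ?_⟩
  -- Fourier coefficients
  have hcoef : ∀ n : ℕ, ∫ t in (0 : ℝ)..(2 * Real.pi),
      (Complex.exp (-(t * Complex.I))) ^ n • h t = ((2 * Real.pi : ℝ) : ℂ) • b n := by
    intro n
    have h1 : HasSum (fun m : ℕ => ∫ t in (0 : ℝ)..(2 * Real.pi),
        (Complex.exp (-(t * Complex.I))) ^ n • (Complex.exp (t * Complex.I)) ^ m • b m)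
        (∫ t in (0 : ℝ)..(2 * Real.pi), (Complex.exp (-(t * Complex.I))) ^ n • h t) := by
      refine intervalIntegral.hasSum_integral_of_dominated_convergence
        (fun m _ => ‖b m‖) (fun m => ?_) (fun m => ?_) ?_ ?_ ?_
      · exact Continuous.aestronglyMeasurable (by fun_prop)
      · refine Filter.Eventually.of_forall fun t _ => ?_
        rw [norm_smul, norm_smul, hnorm, one_mul, norm_pow]
        have : ‖Complex.exp (-(t * Complex.I))‖ = 1 := by
          have := Complex.norm_exp_ofReal_mul_I (-t)
          simpa using this
        rw [this, one_pow, one_mul]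
      · exact Filter.Eventually.of_forall fun t _ => hb
      · exact intervalIntegrable_const
      · exact Filter.Eventually.of_forall fun t _ => (hh t).const_smul _
    refine h1.unique ?_
    have h2 : ∀ m : ℕ, m ≠ n → ∫ t in (0 : ℝ)..(2 * Real.pi),
        (Complex.exp (-(t * Complex.I))) ^ n • (Complex.exp (t * Complex.I)) ^ m • b m = 0 := by
      intro m hmn
      have hc : ((m : ℂ) - n) * Complex.I ≠ 0 := by
        refine mul_ne_zero (sub_ne_zero.2 ?_) Complex.I_ne_zero
        exact_mod_cast hmn
      have : ∀ t : ℝ, (Complex.exp (-(t * Complex.I))) ^ n •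
          (Complex.exp (t * Complex.I)) ^ m • b m =
          Complex.exp (((m : ℂ) - n) * Complex.I * t) • b m := by
        intro t
        rw [smul_smul, ← Complex.exp_nat_mul, ← Complex.exp_nat_mul, ← Complex.exp_add]
        congr 2
        ring
      simp_rw [this]
      rw [intervalIntegral.integral_smul_const, integral_exp_mul_complex hc]
      have : Complex.exp (((m : ℂ) - n) * Complex.I * ((2 * Real.pi : ℝ) : ℂ)) = 1 := by
        rw [Complex.exp_eq_one_iff]
        refine ⟨(m : ℤ) - n, ?_⟩
        push_cast
        ring
      rw [this]
      simp
    have h3 : ∫ t in (0 : ℝ)..(2 * Real.pi),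
        (Complex.exp (-(t * Complex.I))) ^ n • (Complex.exp (t * Complex.I)) ^ n • b n =
        ((2 * Real.pi : ℝ) : ℂ) • b n := by
      have : ∀ t : ℝ, (Complex.exp (-(t * Complex.I))) ^ n •
          (Complex.exp (t * Complex.I)) ^ n • b n = b n := by
        intro t
        rw [smul_smul, ← mul_pow, ← Complex.exp_add]
        simp
      simp_rw [this]
      rw [intervalIntegral.integral_const, sub_zero]
      exact (Complex.coe_smul _ _).symm
    rw [← h3]
    exact hasSum_single n h2
  have h4 : HasSum (fun n : ℕ => ∫ t in (0 : ℝ)..(2 * Real.pi),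
      ⟪(Complex.exp (t * Complex.I)) ^ n • b n, h t⟫_ℂ)
      (∫ t in (0 : ℝ)..(2 * Real.pi), ⟪h t, h t⟫_ℂ) := by
    refine intervalIntegral.hasSum_integral_of_dominated_convergence
      (fun m t => ‖b m‖ * ‖h t‖) (fun m => ?_) (fun m => ?_) ?_ ?_ ?_
    · exact Continuous.aestronglyMeasurable (by fun_prop)
    · refine Filter.Eventually.of_forall fun t _ => ?_
      refine (norm_inner_le_norm _ _).trans ?_
      rw [norm_smul, hnorm, one_mul]
    · exact Filter.Eventually.of_forall fun t _ => hb.mul_right _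
    · simp_rw [tsum_mul_right]
      exact Continuous.intervalIntegrable (by fun_prop) _ _
    · exact Filter.Eventually.of_forall fun t _ => (hh t).mapL (innerSLFlip ℂ (h t))
  have h5 : ∀ n : ℕ, ∫ t in (0 : ℝ)..(2 * Real.pi),
      ⟪(Complex.exp (t * Complex.I)) ^ n • b n, h t⟫_ℂ =
      ((2 * Real.pi * ‖b n‖ ^ 2 : ℝ) : ℂ) := by
    intro n
    have h6 : ∀ t : ℝ, ⟪(Complex.exp (t * Complex.I)) ^ n • b n, h t⟫_ℂ =
        innerSL ℂ (b n) ((Complex.exp (-(t * Complex.I))) ^ n • h t) := by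
      intro t
      rw [innerSL_apply_apply, inner_smul_left, inner_smul_right, map_pow, ← Complex.exp_conj]
      simp
    simp_rw [h6]
    rw [ContinuousLinearMap.intervalIntegral_comp_comm _
      (Continuous.intervalIntegrable (by fun_prop) _ _), hcoef, innerSL_apply_apply,
      inner_smul_right, inner_self_eq_norm_sq_to_K]
    push_cast
    rfl
  have h7 : ∀ t : ℝ, ⟪h t, h t⟫_ℂ = ((‖h t‖ ^ 2 : ℝ) : ℂ) := fun t => by
    rw [inner_self_eq_norm_sq_to_K]
    push_cast
    rfl
  simp_rw [h5, h7] at h4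
  rw [intervalIntegral.integral_ofReal] at h4
  exact_mod_cast h4

/-- Two functions in `H²` with the same values on the disk coincide. -/
theorem HardySpace.ext_eval {f g : HardySpace Y}
    (hfg : ∀ z : ℂ, ‖z‖ < 1 → f.eval z = g.eval z) : f = g := by
  rw [← sub_eq_zero]
  have hd : ∀ t : ℝ, HasSum (fun n : ℕ => (Complex.exp (t * Complex.I)) ^ n •
      ((1 / 2 : ℂ) ^ n • (f - g) n)) ((fun _ => 0 : ℝ → Y) t) := by
    intro t
    have hz : ‖(1 / 2 : ℂ) * Complex.exp (t * Complex.I)‖ < 1 := by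
      rw [norm_mul, Complex.norm_exp_ofReal_mul_I]
      norm_num
    have := (f.hasSum_eval hz).sub (g.hasSum_eval hz)
    rw [hfg _ hz, sub_self] at this
    convert! this using 2 with n
    rw [smul_smul, ← smul_sub, ← mul_pow, mul_comm]
    rfl
  have hs : Summable fun n : ℕ => ‖(1 / 2 : ℂ) ^ n • (f - g) n‖ :=
    (f - g).summable_norm (by norm_num)
  have h1 := (hardy_parseval _ hs _ hd).2
  simp only [norm_zero, ne_eq, OfNat.ofNat_ne_zero, not_false_eq_true, zero_pow,
    intervalIntegral.integral_zero] at h1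
  have h2 := (hasSum_zero_iff_of_nonneg (fun n => by positivity)).1 h1
  ext n
  have h3 := congrFun h2 n
  simpa [Real.pi_ne_zero] using h3

end HardyFacts

section Toeplitz

variable {U Y : Type*} [NormedAddCommGroup U] [InnerProductSpace ℂ U] [CompleteSpace U]
  [NormedAddCommGroup Y] [InnerProductSpace ℂ Y] [CompleteSpace Y]

/-- Multiplication by a Schur function maps `H²(𝒰)` contractively into `H²(𝒴)`. -/
theorem IsSchur.exists_mul {S : ℂ → U →L[ℂ] Y} (hS : IsSchur S) (f : HardySpace U) :
    ∃ g : HardySpace Y, ‖g‖ ≤ ‖f‖ ∧ ∀ z : ℂ, ‖z‖ < 1 → g.eval z = S z (f.eval z) := by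
  have hdiff : DifferentiableOn ℂ (fun z => S z (f.eval z)) (Metric.ball 0 1) :=
    hS.differentiableOn.clm_apply f.differentiableOn_eval
  set a : ℕ → Y := fun n =>
    (n.factorial : ℂ)⁻¹ • iteratedDeriv n (fun z => S z (f.eval z)) 0 with ha
  have hsum : ∀ z : ℂ, ‖z‖ < 1 → HasSum (fun n : ℕ => z ^ n • a n) (S z (f.eval z)) := by
    intro z hz
    have := Complex.hasSum_taylorSeries_on_ball hdiff (z := z) (by simpa using hz)
    convert! this using 2 with n
    rw [sub_zero, smul_comm]
  have hnorm : ∀ z : ℂ, ‖z‖ < 1 → Summable fun n : ℕ => ‖z ^ n • a n‖ := by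
    intro z hz
    obtain ⟨r, hzr, hr⟩ := exists_between hz
    have hr0 : 0 < r := (norm_nonneg z).trans_lt hzr
    have hb := (hsum (r : ℂ) (by simpa [abs_of_pos hr0] using hr)).summable.tendsto_atTop_zero
    obtain ⟨C, hC⟩ := (Metric.isBounded_range_of_tendsto _ hb).exists_norm_le
    refine Summable.of_nonneg_of_le (fun _ => norm_nonneg _) (fun n => ?_)
      ((summable_geometric_of_lt_one (r := ‖z‖ / r) (by positivity)
        ((div_lt_one hr0).2 hzr)).mul_left C)
    have h1 := hC _ ⟨n, rfl⟩
    simp only [norm_smul, norm_pow, Complex.norm_real, Real.norm_eq_abs, abs_of_pos hr0] at h1 ⊢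
    calc ‖z‖ ^ n * ‖a n‖ = (r ^ n * ‖a n‖) * (‖z‖ / r) ^ n := by
          rw [div_pow]; field_simp
      _ ≤ C * (‖z‖ / r) ^ n := by gcongr
  have hfin : ∀ s : Finset ℕ, ∑ n ∈ s, ‖a n‖ ^ 2 ≤ ‖f‖ ^ 2 := by
    intro s
    have hfs : HasSum (fun n => ‖f n‖ ^ 2) (‖f‖ ^ 2) := by
      have := lp.hasSum_norm (p := 2) (by norm_num) f
      simpa using this
    have hr : ∀ r : ℝ, r ∈ Set.Ioo (0 : ℝ) 1 → ∑ n ∈ s, ‖((r : ℂ) ^ n) • a n‖ ^ 2 ≤ ‖f‖ ^ 2 := by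
      rintro r ⟨hr0, hr1⟩
      have hrn : ‖(r : ℂ)‖ < 1 := by simpa [abs_of_pos hr0] using hr1
      have hz : ∀ t : ℝ, ‖(r : ℂ) * Complex.exp (t * Complex.I)‖ < 1 := fun t => by
        rw [norm_mul, Complex.norm_exp_ofReal_mul_I, mul_one]
        exact hrn
      obtain ⟨c1, p1⟩ := hardy_parseval (fun n => (r : ℂ) ^ n • a n) (hnorm _ hrn)
        (fun t => S (r * Complex.exp (t * Complex.I)) (f.eval (r * Complex.exp (t * Complex.I))))
        (fun t => by
          convert! hsum _ (hz t) using 2 with n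
          rw [smul_smul, ← mul_pow, mul_comm])
      obtain ⟨c2, p2⟩ := hardy_parseval (fun n => (r : ℂ) ^ n • f n) (f.summable_norm hrn)
        (fun t => f.eval (r * Complex.exp (t * Complex.I)))
        (fun t => by
          convert! f.hasSum_eval (hz t) using 2 with n
          rw [smul_smul, ← mul_pow, mul_comm])
      have hle : (∫ t in (0 : ℝ)..(2 * Real.pi), ‖S (r * Complex.exp (t * Complex.I))
            (f.eval (r * Complex.exp (t * Complex.I)))‖ ^ 2) ≤
          ∫ t in (0 : ℝ)..(2 * Real.pi), ‖f.eval (r * Complex.exp (t * Complex.I))‖ ^ 2 := by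
        refine intervalIntegral.integral_mono (by positivity)
          ((c1.norm.pow 2).intervalIntegrable _ _) ((c2.norm.pow 2).intervalIntegrable _ _)
          fun t => ?_
        dsimp only
        gcongr
        have := (S (r * Complex.exp (t * Complex.I))).le_of_opNorm_le
          (hS.norm_le_one _ (by simpa using hz t)) (f.eval (r * Complex.exp (t * Complex.I)))
        simpa using this
      have h1 : ∑ n ∈ s, 2 * Real.pi * ‖(r : ℂ) ^ n • a n‖ ^ 2 ≤ 2 * Real.pi * ‖f‖ ^ 2 := by
        refine (sum_le_hasSum s (fun n _ => by positivity) p1).trans (hle.trans ?_)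
        refine hasSum_le (fun n => ?_) p2 (hfs.mul_left _)
        gcongr
        rw [norm_smul, norm_pow]
        exact mul_le_of_le_one_left (norm_nonneg _) (pow_le_one₀ (norm_nonneg _) hrn.le)
      rw [← Finset.mul_sum] at h1
      exact le_of_mul_le_mul_left h1 (by positivity)
    have hc : Continuous fun r : ℝ => ∑ n ∈ s, ‖((r : ℂ) ^ n) • a n‖ ^ 2 := by fun_prop
    have ht := (hc.tendsto 1).mono_left (nhdsWithin_le_nhds (s := Set.Iio 1))
    simp only [Complex.ofReal_one, one_pow, one_smul] at ht
    refine le_of_tendsto ht ?_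
    filter_upwards [Ioo_mem_nhdsLT (zero_lt_one' ℝ)] with r hr' using hr r hr'
  have hmem : Memℓp a 2 := memℓp_gen' (C := ‖f‖ ^ 2) fun s => by simpa using hfin s
  refine ⟨⟨a, hmem⟩, lp.norm_le_of_forall_sum_le (by norm_num) (norm_nonneg _) fun s => ?_,
    fun z hz => (hsum z hz).tsum_eq⟩
  simpa using hfin s

theorem HardySpace.eval_add (f g : HardySpace U) {z : ℂ} (hz : ‖z‖ < 1) :
    (f + g).eval z = f.eval z + g.eval z := by
  refine (((f + g).hasSum_eval hz).unique ?_)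
  simpa only [lp.coeFn_add, Pi.add_apply, smul_add] using (f.hasSum_eval hz).add (g.hasSum_eval hz)

theorem HardySpace.eval_smul (c : ℂ) (f : HardySpace U) {z : ℂ} (hz : ‖z‖ < 1) :
    (c • f).eval z = c • f.eval z := by
  refine (((c • f).hasSum_eval hz).unique ?_)
  simpa only [lp.coeFn_smul, Pi.smul_apply, smul_comm c] using (f.hasSum_eval hz).const_smul c

/-- The (analytic Toeplitz) multiplication operator `T_S : H²(𝒰) → H²(𝒴)`, `f ↦ S f`, of a Schur
function `S`: the value at `f` is the element of `H²(𝒴)` equal to `z ↦ S(z) f(z)` on the disk,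
see `toeplitz_eval`; by `HardySpace.ext_eval` it is unique. -/
def toeplitz (S : ℂ → U →L[ℂ] Y) (hS : IsSchur S) : HardySpace U →L[ℂ] HardySpace Y :=
  LinearMap.mkContinuous
    { toFun := fun f => (hS.exists_mul f).choose
      map_add' := fun f g => HardySpace.ext_eval fun z hz => by
        rw [HardySpace.eval_add _ _ hz, (hS.exists_mul (f + g)).choose_spec.2 z hz,
          (hS.exists_mul f).choose_spec.2 z hz, (hS.exists_mul g).choose_spec.2 z hz,
          HardySpace.eval_add _ _ hz, map_add]
      map_smul' := fun c f => HardySpace.ext_eval fun z hz => by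
        rw [RingHom.id_apply, HardySpace.eval_smul _ _ hz,
          (hS.exists_mul (c • f)).choose_spec.2 z hz,
          (hS.exists_mul f).choose_spec.2 z hz, HardySpace.eval_smul _ _ hz, map_smul] }
    1 fun f => by simpa using (hS.exists_mul f).choose_spec.1

theorem toeplitz_eval (S : ℂ → U →L[ℂ] Y) (hS : IsSchur S) (f : HardySpace U) {z : ℂ}
    (hz : ‖z‖ < 1) : (toeplitz S hS f).eval z = S z (f.eval z) :=
  (hS.exists_mul f).choose_spec.2 z hz

theorem toeplitz_norm_le (S : ℂ → U →L[ℂ] Y) (hS : IsSchur S) : ‖toeplitz S hS‖ ≤ 1 :=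
  LinearMap.mkContinuous_norm_le _ zero_le_one _

end Toeplitz

section Observability

variable {X Y : Type*} [NormedAddCommGroup X] [InnerProductSpace ℂ X] [CompleteSpace X]
  [NormedAddCommGroup Y] [InnerProductSpace ℂ Y] [CompleteSpace Y]

/-- The pair `(E, T)` is output stable: for every `x` the power series
`E (I - zT)⁻¹ x = ∑ zⁿ E Tⁿ x` belongs to `H²(𝒴)`. -/
def OutputStable (E : X →L[ℂ] Y) (T : X →L[ℂ] X) : Prop :=
  ∀ x : X, Memℓp (fun n : ℕ => E ((T ^ n) x)) 2

/-- The observability operator `𝒪_{E,T} : 𝒳 → H²(𝒴)`, `x ↦ E (I - zT)⁻¹ x`, of an output stable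
pair, that is, `x ↦ ∑ zⁿ E Tⁿ x`.  It is bounded by the closed graph theorem. -/
def observability (E : X →L[ℂ] Y) (T : X →L[ℂ] X) (h : OutputStable E T) :
    X →L[ℂ] HardySpace Y :=
  ContinuousLinearMap.ofSeqClosedGraph
    (g := { toFun := fun x => ⟨fun n => E ((T ^ n) x), h x⟩
            map_add' := fun x y => by ext n; exact (E ∘L (T ^ n)).map_add x y
            map_smul' := fun c x => by ext n; exact (E ∘L (T ^ n)).map_smul c x })
    (by
      intro u x y hu hy
      ext n
      have h1 := ((lp.evalCLM ℂ (fun _ : ℕ => Y) 2 n).continuous.tendsto y).comp hy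
      have h2 := ((E ∘L (T ^ n)).continuous.tendsto x).comp hu
      exact tendsto_nhds_unique h1 h2)

theorem observability_apply (E : X →L[ℂ] Y) (T : X →L[ℂ] X) (h : OutputStable E T) (x : X)
    (n : ℕ) : observability E T h x n = E ((T ^ n) x) := rfl

/-- At each point of the disk at which `I - zT` is invertible, the value of `𝒪_{E,T} x` is
`E (I - zT)⁻¹ x`. -/
theorem observability_eval (E : X →L[ℂ] Y) (T : X →L[ℂ] X) (h : OutputStable E T) (x : X)
    {z : ℂ} (hz : ‖z‖ < 1) (hu : IsUnit (1 - z • T)) :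
    (observability E T h x).eval z = E (Ring.inverse (1 - z • T) x) := by
  set y := Ring.inverse (1 - z • T) x with hy
  have hx : x = y - z • T y := by
    have := congrArg (fun A : X →L[ℂ] X => A x) (Ring.mul_inverse_cancel _ hu)
    simpa using this.symm
  have h0 := (observability E T h y).hasSum_eval hz
  have h2 : HasSum (fun n : ℕ => z ^ (n + 1) • observability E T h y (n + 1))
      ((observability E T h y).eval z - E y) := by
    have := (hasSum_nat_add_iff' 1).2 h0
    simpa [observability_apply] using this
  have h3 := h0.sub h2
  rw [sub_sub_cancel] at h3
  refine ((observability E T h x).hasSum_eval hz).unique ?_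
  convert! h3 using 2 with n
  simp only [observability_apply]
  conv_lhs => rw [hx]
  simp only [map_sub, map_smul, smul_sub, smul_smul, pow_succ, mul_apply_eq_comp]

end Observability

section Problem

variable {X U Y : Type*}
  [NormedAddCommGroup X] [InnerProductSpace ℂ X] [CompleteSpace X]
  [NormedAddCommGroup U] [InnerProductSpace ℂ U] [CompleteSpace U]
  [NormedAddCommGroup Y] [InnerProductSpace ℂ Y] [CompleteSpace Y]

/-- `S` solves the interpolation problem with data `(T, E, N)`: it is a Schur-class function with
`T_S^* 𝒪_{E,T} = 𝒪_{N,T}`. -/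
def IsInterpolant (T : X →L[ℂ] X) (E : X →L[ℂ] Y) (N : X →L[ℂ] U)
    (hE : OutputStable E T) (hN : OutputStable N T) (S : ℂ → U →L[ℂ] Y) : Prop :=
  ∃ hS : IsSchur S,
    ContinuousLinearMap.adjoint (toeplitz S hS) ∘L observability E T hE = observability N T hN

/-- The Pick operator `P = 𝒪_{E,T}^* 𝒪_{E,T} - 𝒪_{N,T}^* 𝒪_{N,T}`. -/
def pickOperator (T : X →L[ℂ] X) (E : X →L[ℂ] Y) (N : X →L[ℂ] U)
    (hE : OutputStable E T) (hN : OutputStable N T) : X →L[ℂ] X :=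
  ContinuousLinearMap.adjoint (observability E T hE) ∘L observability E T hE -
    ContinuousLinearMap.adjoint (observability N T hN) ∘L observability N T hN

end Problem

end

/-! Necessity: `T_S^*` is a contraction, so `‖𝒪_{N,T} x‖ ≤ ‖𝒪_{E,T} x‖`, which is `P ≥ 0`.

Sufficiency is a lurking isometry argument. Put `Q = P^{1/2}`, so that `‖Qx‖² = ‖𝒪_{E,T} x‖² -
‖𝒪_{N,T} x‖²`. Replacing `x` by `Tx` removes the zeroth Taylor coefficient
(`norm_sq_observability_map`), whence `‖QTx‖² + ‖Ex‖² = ‖Qx‖² + ‖Nx‖²`. The isometry `(QTx, Ex) ↦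
(Qx, Nx)` extends by zero to a contraction; its adjoint is a contractive colligation `[A B; C D]`
(`exists_isContractiveColligation`), and `S(z) = D + zC(I - zA)⁻¹B` is a Schur function
(`isSchur_transferFunction`).

Iterating the adjoint relations expands `⟪u, Nx⟫` as `∑ ⟪S_k u, E T^k x⟫`, with `S_k` the Taylor
coefficients of `S` (`hasSum_inner_markovParameter`). The remainder vanishes since `‖Q T^n x‖ ≤
‖𝒪_{E,T} T^n x‖ → 0`; no stability of `A` is needed. Applied to `T^n x`, this is the equality of the
`n`-th coefficients in `T_S^* 𝒪_{E,T} x = 𝒪_{N,T} x`. -/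

open scoped InnerProductSpace Topology
open Filter

/-! ### Factorization through a contraction. -/

section DouglasFactorization

variable {V W₁ W₂ : Type*} [AddCommGroup V] [Module ℂ V]
  [NormedAddCommGroup W₁] [InnerProductSpace ℂ W₁] [CompleteSpace W₁]
  [NormedAddCommGroup W₂] [InnerProductSpace ℂ W₂] [CompleteSpace W₂]

/-- If `‖b x‖ ≤ ‖a x‖` for all `x`, then `b` factors through `a` by a contraction. -/
theorem LinearMap.exists_contraction_comp_eq (a : V →ₗ[ℂ] W₁) (b : V →ₗ[ℂ] W₂)
    (hab : ∀ x, ‖b x‖ ≤ ‖a x‖) :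
    ∃ K : W₁ →L[ℂ] W₂, (∀ w, ‖K w‖ ≤ ‖w‖) ∧ ∀ x, K (a x) = b x := by
  let M : Submodule ℂ W₁ := (LinearMap.range a).topologicalClosure
  have hmem : ∀ x, a x ∈ M := fun x =>
    (LinearMap.range a).le_topologicalClosure (LinearMap.mem_range_self a x)
  have : CompleteSpace M := (LinearMap.range a).isClosed_topologicalClosure.completeSpace_coe
  let e : V →ₗ[ℂ] M := a.codRestrict M hmem
  have he : DenseRange e := by
    intro y
    rw [closure_subtype]
    have hr : (Subtype.val '' Set.range e : Set W₁) = LinearMap.range a := by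
      ext w
      simp [e]
    rw [hr]
    exact y.2
  have hn : ∀ x, ‖b x‖ ≤ 1 * ‖e x‖ := fun x => by
    rw [one_mul]
    exact hab x
  -- `K` is the continuous extension to the closure of the range of `a`, and zero on its orthogonal
  -- complement.
  refine ⟨b.extendOfNorm e ∘L M.orthogonalProjectionOnto, fun w => ?_, fun x => ?_⟩
  · refine (LinearMap.norm_extendOfNorm_apply_le he 1 hn _).trans ?_
    rw [one_mul]
    exact M.norm_orthogonalProjectionOnto_apply_le w
  · have h1 : M.orthogonalProjectionOnto (a x) = e x :=
      M.orthogonalProjectionOnto_mem_subspace_eq_self (e x)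
    rw [ContinuousLinearMap.comp_apply, h1, LinearMap.extendOfNorm_eq he ⟨1, hn⟩]

end DouglasFactorization

/-- The Taylor coefficients of a function in `H²` are determined by its values on the disk. -/
theorem HardySpace.coeff_eq_of_hasSum {Y : Type*} [NormedAddCommGroup Y] [InnerProductSpace ℂ Y]
    [CompleteSpace Y] (f : HardySpace Y) {C : ℝ} (c : ℕ → Y) (hc : ∀ n, ‖c n‖ ≤ C)
    (hf : ∀ z : ℂ, ‖z‖ < 1 → HasSum (fun n : ℕ => z ^ n • c n) (f.eval z)) (n : ℕ) :
    f n = c n := by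
  -- The `c n` are only bounded, so the series are compared on the circle of radius `1/2`, where
  -- they converge absolutely and Parseval applies.
  have hd : ∀ t : ℝ, HasSum (fun n : ℕ => (Complex.exp (t * Complex.I)) ^ n •
      ((1 / 2 : ℂ) ^ n • (f n - c n))) ((fun _ => 0 : ℝ → Y) t) := by
    intro t
    have hz : ‖(1 / 2 : ℂ) * Complex.exp (t * Complex.I)‖ < 1 := by
      rw [norm_mul, Complex.norm_exp_ofReal_mul_I]
      norm_num
    have := (f.hasSum_eval hz).sub (hf _ hz)
    rw [sub_self] at this
    convert! this using 2 with n
    rw [smul_smul, ← smul_sub, ← mul_pow, mul_comm]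
  have hs : Summable fun n : ℕ => ‖(1 / 2 : ℂ) ^ n • (f n - c n)‖ := by
    refine Summable.of_nonneg_of_le (fun _ => norm_nonneg _) (fun k => ?_)
      ((summable_geometric_of_lt_one (r := 1 / 2) (by norm_num) (by norm_num)).mul_left (‖f‖ + C))
    have h1 : ‖f k - c k‖ ≤ ‖f‖ + C := (norm_sub_le _ _).trans
      (add_le_add (lp.norm_apply_le_norm two_ne_zero f k) (hc k))
    have h2 : ‖(1 / 2 : ℂ) ^ k‖ = (1 / 2 : ℝ) ^ k := by simp
    rw [norm_smul, h2, mul_comm]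
    gcongr
  have h1 := (hardy_parseval _ hs _ hd).2
  simp only [norm_zero, ne_eq, OfNat.ofNat_ne_zero, not_false_eq_true, zero_pow,
    intervalIntegral.integral_zero] at h1
  have h3 := congrFun ((hasSum_zero_iff_of_nonneg (fun n => by positivity)).1 h1) n
  simpa [Real.pi_ne_zero, sub_eq_zero] using h3

/-! ### Contractive colligations and their transfer functions. -/

section TransferFunction

variable {H U Y : Type*}
  [NormedAddCommGroup H] [InnerProductSpace ℂ H]
  [NormedAddCommGroup U] [InnerProductSpace ℂ U]
  [NormedAddCommGroup Y] [InnerProductSpace ℂ Y]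

/-- The colligation `(h, u) ↦ (A h + B u, C h + D u)` is contractive. -/
def IsContractiveColligation (A : H →L[ℂ] H) (B : U →L[ℂ] H) (C : H →L[ℂ] Y)
    (D : U →L[ℂ] Y) : Prop :=
  ∀ h u, ‖A h + B u‖ ^ 2 + ‖C h + D u‖ ^ 2 ≤ ‖h‖ ^ 2 + ‖u‖ ^ 2

/-- The transfer function `D + z C (I - zA)⁻¹ B`. -/
noncomputable def transferFunction (A : H →L[ℂ] H) (B : U →L[ℂ] H) (C : H →L[ℂ] Y) (D : U →L[ℂ] Y)
    (z : ℂ) : U →L[ℂ] Y :=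
  D + z • (C ∘L Ring.inverse (1 - z • A) ∘L B)

/-- The Taylor coefficients `D, CB, CAB, CA²B, …` of the transfer function. -/
def markovParameter (A : H →L[ℂ] H) (B : U →L[ℂ] H) (C : H →L[ℂ] Y) (D : U →L[ℂ] Y) :
    ℕ → U →L[ℂ] Y
  | 0 => D
  | n + 1 => C ∘L (A ^ n) ∘L B

variable {A : H →L[ℂ] H} {B : U →L[ℂ] H} {C : H →L[ℂ] Y} {D : U →L[ℂ] Y}

namespace IsContractiveColligation

theorem norm_state_le (hK : IsContractiveColligation A B C D) (h : H) : ‖A h‖ ≤ ‖h‖ := by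
  have := hK h 0
  simp only [map_zero, add_zero, norm_zero] at this
  refine (sq_le_sq₀ (norm_nonneg _) (norm_nonneg _)).1 ?_
  nlinarith [sq_nonneg ‖C h‖]

theorem norm_output_le (hK : IsContractiveColligation A B C D) (h : H) : ‖C h‖ ≤ ‖h‖ := by
  have := hK h 0
  simp only [map_zero, add_zero, norm_zero] at this
  refine (sq_le_sq₀ (norm_nonneg _) (norm_nonneg _)).1 ?_
  nlinarith [sq_nonneg ‖A h‖]

theorem norm_input_le (hK : IsContractiveColligation A B C D) (u : U) : ‖B u‖ ≤ ‖u‖ := by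
  have := hK 0 u
  simp only [map_zero, zero_add, norm_zero] at this
  refine (sq_le_sq₀ (norm_nonneg _) (norm_nonneg _)).1 ?_
  nlinarith [sq_nonneg ‖D u‖]

theorem norm_feedthrough_le (hK : IsContractiveColligation A B C D) (u : U) : ‖D u‖ ≤ ‖u‖ := by
  have := hK 0 u
  simp only [map_zero, zero_add, norm_zero] at this
  refine (sq_le_sq₀ (norm_nonneg _) (norm_nonneg _)).1 ?_
  nlinarith [sq_nonneg ‖B u‖]

theorem norm_pow_input_le (hK : IsContractiveColligation A B C D) (u : U) (n : ℕ) :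
    ‖(A ^ n) (B u)‖ ≤ ‖u‖ := by
  induction n with
  | zero => simpa using hK.norm_input_le u
  | succ n ih =>
    rw [pow_succ', mul_apply_eq_comp]
    exact (hK.norm_state_le _).trans ih

theorem norm_markovParameter_le (hK : IsContractiveColligation A B C D) (u : U) (n : ℕ) :
    ‖markovParameter A B C D n u‖ ≤ ‖u‖ := by
  cases n with
  | zero => exact hK.norm_feedthrough_le u
  | succ n => exact (hK.norm_output_le _).trans (hK.norm_pow_input_le u n)

variable [CompleteSpace H]

theorem norm_smul_lt_one (hK : IsContractiveColligation A B C D) {z : ℂ} (hz : ‖z‖ < 1) :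
    ‖z • A‖ < 1 := by
  rw [norm_smul]
  refine (mul_le_of_le_one_right (norm_nonneg z) ?_).trans_lt hz
  exact A.opNorm_le_bound zero_le_one fun h => by simpa using hK.norm_state_le h

theorem hasSum_transferFunction (hK : IsContractiveColligation A B C D) {z : ℂ} (hz : ‖z‖ < 1)
    (u : U) :
    HasSum (fun n : ℕ => z ^ n • markovParameter A B C D n u)
      (transferFunction A B C D z u) := by
  have h1 := hasSum_geom_series_inverse (z • A) (hK.norm_smul_lt_one hz)
  have h2 := h1.mapL (ContinuousLinearMap.apply ℂ H (B u))
  have h3 := (h2.mapL C).const_smul z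
  -- Without the constant term `D u`, the series is `z C` applied to the Neumann series of `zA` at
  -- `B u`.
  rw [← hasSum_nat_add_iff' 1]
  convert! h3 using 1
  · ext n
    simp [markovParameter, smul_pow, smul_smul, pow_succ']
  · simp [markovParameter, transferFunction]

/-- With `h = (I - zA)⁻¹Bu`, the colligation sends `(zh, u)` to `(h, S(z)u)`. Contractivity gives
`‖h‖² + ‖S(z)u‖² ≤ |z|²‖h‖² + ‖u‖²`, and `|z| < 1` lets `‖h‖²` be dropped. -/
theorem isSchur_transferFunction (hK : IsContractiveColligation A B C D) :
    IsSchur (transferFunction A B C D) where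
  differentiableOn := by
    intro z hz
    rw [mem_ball_zero_iff] at hz
    have hu : IsUnit (1 - z • A) := (Units.oneSub _ (hK.norm_smul_lt_one hz)).isUnit
    have h1 : DifferentiableAt ℂ (fun z : ℂ => Ring.inverse (1 - z • A)) z :=
      DifferentiableAt.comp (g := Ring.inverse) z (differentiableAt_inverse hu)
        (by fun_prop : DifferentiableAt ℂ (fun z : ℂ => 1 - z • A) z)
    refine DifferentiableAt.differentiableWithinAt ?_
    unfold transferFunction
    fun_prop
  norm_le_one := by
    intro z hz
    rw [mem_ball_zero_iff] at hz
    have hu : IsUnit (1 - z • A) := (Units.oneSub _ (hK.norm_smul_lt_one hz)).isUnit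
    refine ContinuousLinearMap.opNorm_le_bound _ zero_le_one fun u => ?_
    set h := Ring.inverse (1 - z • A) (B u) with hh
    have h1 : A (z • h) + B u = h := by
      have := congrArg (fun R : H →L[ℂ] H => R (B u)) (Ring.mul_inverse_cancel _ hu)
      simp only [mul_apply_eq_comp, ← hh, sub_apply,
        smul_apply, one_apply_eq_self] at this
      rw [map_smul, ← this]
      abel
    have h2 : C (z • h) + D u = transferFunction A B C D z u := by
      simp [transferFunction, ← hh, add_comm]
    have h3 := hK (z • h) u
    rw [h1, h2, norm_smul] at h3
    rw [one_mul]
    refine (sq_le_sq₀ (norm_nonneg _) (norm_nonneg _)).1 ?_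
    have h4 : (‖z‖ * ‖h‖) ^ 2 ≤ ‖h‖ ^ 2 := by
      gcongr
      exact mul_le_of_le_one_left (norm_nonneg _) hz.le
    linarith

variable [CompleteSpace U] [CompleteSpace Y]

/-- `T_S` maps `zⁿ u` to the function with the Markov parameters, shifted by `n`, as Taylor
coefficients. -/
theorem toeplitz_single (hK : IsContractiveColligation A B C D) (n : ℕ) (u : U) (k : ℕ) :
    toeplitz _ hK.isSchur_transferFunction (lp.single 2 n u) k =
      if n ≤ k then markovParameter A B C D (k - n) u else 0 := by
  refine HardySpace.coeff_eq_of_hasSum _ (C := ‖u‖)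
    (fun k => if n ≤ k then markovParameter A B C D (k - n) u else 0) (fun k => ?_)
    (fun z hz => ?_) k
  · split_ifs
    · exact hK.norm_markovParameter_le u _
    · simp
  · rw [toeplitz_eval _ _ _ hz]
    have h1 : HardySpace.eval (lp.single 2 n u : HardySpace U) z = z ^ n • u := by
      rw [HardySpace.eval, tsum_eq_single n]
      · simp
      · intro m hm
        simp [hm]
    -- The value is `z^n S(z) u`: the first `n` coefficients vanish and the rest form the series of
    -- `S(z) u`.
    rw [h1, map_smul, ← hasSum_nat_add_iff' n]
    have h2 : ∑ i ∈ Finset.range n,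
        z ^ i • (if n ≤ i then markovParameter A B C D (i - n) u else 0) = 0 :=
      Finset.sum_eq_zero fun i hi => by
        rw [if_neg (by simpa using hi), smul_zero]
    rw [h2, sub_zero]
    convert! (hK.hasSum_transferFunction hz u).const_smul (z ^ n) using 2 with i
    simp [smul_smul, pow_add, mul_comm]

end IsContractiveColligation

end TransferFunction

/-! ### From an isometric identity to a colligation. -/

section LurkingIsometry

variable {X H U Y : Type*}
  [NormedAddCommGroup X] [InnerProductSpace ℂ X]
  [NormedAddCommGroup H] [InnerProductSpace ℂ H] [CompleteSpace H]
  [NormedAddCommGroup U] [InnerProductSpace ℂ U] [CompleteSpace U]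
  [NormedAddCommGroup Y] [InnerProductSpace ℂ Y] [CompleteSpace Y]

/-- An isometry `(F x, E x) ↦ (G x, N x)` between subspaces is the restriction of the adjoint of
a contractive colligation. -/
theorem exists_isContractiveColligation (F G : X →L[ℂ] H) (E : X →L[ℂ] Y) (N : X →L[ℂ] U)
    (hiso : ∀ x, ‖F x‖ ^ 2 + ‖E x‖ ^ 2 = ‖G x‖ ^ 2 + ‖N x‖ ^ 2) :
    ∃ (A : H →L[ℂ] H) (B : U →L[ℂ] H) (C : H →L[ℂ] Y) (D : U →L[ℂ] Y),
      IsContractiveColligation A B C D ∧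
      (∀ h x, ⟪h, G x⟫_ℂ = ⟪A h, F x⟫_ℂ + ⟪C h, E x⟫_ℂ) ∧
      ∀ u x, ⟪u, N x⟫_ℂ = ⟪B u, F x⟫_ℂ + ⟪D u, E x⟫_ℂ := by
  -- `WithLp 2` gives the Hilbert direct sum; the plain product carries the sup norm.
  let a : X →L[ℂ] WithLp 2 (H × Y) :=
    (WithLp.prodContinuousLinearEquiv 2 ℂ H Y).symm.toContinuousLinearMap ∘L F.prod E
  let b : X →L[ℂ] WithLp 2 (H × U) :=
    (WithLp.prodContinuousLinearEquiv 2 ℂ H U).symm.toContinuousLinearMap ∘L G.prod N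
  let ι := (WithLp.prodContinuousLinearEquiv 2 ℂ H U).symm.toContinuousLinearMap
  have hι : ∀ h u, ‖ι (h, u)‖ ^ 2 = ‖h‖ ^ 2 + ‖u‖ ^ 2 := fun h u =>
    WithLp.prod_norm_sq_eq_of_L2 _
  obtain ⟨K, hK, hKa⟩ := LinearMap.exists_contraction_comp_eq a.toLinearMap b.toLinearMap
    (fun x => by
      refine (sq_le_sq₀ (norm_nonneg _) (norm_nonneg _)).1 ?_
      have h1 : ‖a x‖ ^ 2 = ‖F x‖ ^ 2 + ‖E x‖ ^ 2 := WithLp.prod_norm_sq_eq_of_L2 _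
      have h2 : ‖b x‖ ^ 2 = ‖G x‖ ^ 2 + ‖N x‖ ^ 2 := WithLp.prod_norm_sq_eq_of_L2 _
      exact (h2.trans ((hiso x).symm.trans h1.symm)).le)
  let L := ContinuousLinearMap.adjoint K
  have hL : ∀ w, ‖L w‖ ≤ ‖w‖ := fun w => by
    refine (L.le_of_opNorm_le (c := 1) ?_ w).trans_eq (one_mul _)
    rw [ContinuousLinearMap.adjoint.norm_map]
    exact K.opNorm_le_bound zero_le_one fun w => by simpa using hK w
  have hin : ∀ w x, ⟪w, b x⟫_ℂ = ⟪(L w).fst, F x⟫_ℂ + ⟪(L w).snd, E x⟫_ℂ := fun w x => by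
    have h1 : ⟪L w, a x⟫_ℂ = ⟪w, b x⟫_ℂ := by
      rw [ContinuousLinearMap.adjoint_inner_left]
      exact congrArg _ (hKa x)
    rw [← h1]
    exact WithLp.prod_inner_apply _ _
  -- The four operators are the blocks of `L = K^*`, so pairing `K (F x, E x) = (G x, N x)` with
  -- `(h, 0)` and `(0, u)` yields the two relations.
  refine ⟨WithLp.fstL 2 ℂ H Y ∘L L ∘L ι ∘L .inl ℂ H U, WithLp.fstL 2 ℂ H Y ∘L L ∘L ι ∘L .inr ℂ H U,
    WithLp.sndL 2 ℂ H Y ∘L L ∘L ι ∘L .inl ℂ H U, WithLp.sndL 2 ℂ H Y ∘L L ∘L ι ∘L .inr ℂ H U,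
    fun h u => ?_, fun h x => ?_, fun u x => ?_⟩
  · have h1 : ι (h, 0) + ι (0, u) = ι (h, u) := by
      rw [← map_add]
      simp
    have h2 : ‖L (ι (h, u))‖ ^ 2 = ‖(L (ι (h, 0)) + L (ι (0, u))).fst‖ ^ 2 +
        ‖(L (ι (h, 0)) + L (ι (0, u))).snd‖ ^ 2 := by
      rw [← h1, map_add]
      exact WithLp.prod_norm_sq_eq_of_L2 _
    rw [← hι h u]
    refine h2.symm.trans_le ?_
    gcongr
    exact hL _
  · refine Eq.trans ?_ (hin (ι (h, 0)) x)
    rw [WithLp.prod_inner_apply]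
    simp [ι, b]
  · refine Eq.trans ?_ (hin (ι (0, u)) x)
    rw [WithLp.prod_inner_apply]
    simp [ι, b]

end LurkingIsometry

/-! ### Observability norms along the orbit of `T`. -/

section Observability

variable {X U Y : Type*}
  [NormedAddCommGroup X] [InnerProductSpace ℂ X] [CompleteSpace X]
  [NormedAddCommGroup U] [InnerProductSpace ℂ U] [CompleteSpace U]
  [NormedAddCommGroup Y] [InnerProductSpace ℂ Y] [CompleteSpace Y]

theorem hasSum_norm_sq_observability (E : X →L[ℂ] Y) (T : X →L[ℂ] X) (h : OutputStable E T)
    (x : X) : HasSum (fun n => ‖E ((T ^ n) x)‖ ^ 2) (‖observability E T h x‖ ^ 2) := by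
  have := lp.hasSum_norm (p := 2) (by norm_num) (observability E T h x)
  simpa [observability_apply] using this

/-- The coefficients at `T x` are those at `x` shifted back by one, so only `E x` is lost. -/
theorem norm_sq_observability_map (E : X →L[ℂ] Y) (T : X →L[ℂ] X) (h : OutputStable E T)
    (x : X) : ‖observability E T h (T x)‖ ^ 2 = ‖observability E T h x‖ ^ 2 - ‖E x‖ ^ 2 := by
  have h1 := (hasSum_nat_add_iff' 1).2 (hasSum_norm_sq_observability E T h x)
  have h2 := hasSum_norm_sq_observability E T h (T x)
  simp only [pow_succ T, mul_apply_eq_comp] at h1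
  simpa only [Finset.sum_range_one, pow_zero, one_apply_eq_self] using h2.unique h1

/-- These are the tails of the convergent series `∑ ‖E T^k x‖²`. -/
theorem tendsto_norm_sq_observability_pow (E : X →L[ℂ] Y) (T : X →L[ℂ] X)
    (h : OutputStable E T) (x : X) :
    Tendsto (fun n => ‖observability E T h ((T ^ n) x)‖ ^ 2) atTop (𝓝 0) := by
  have h1 := tendsto_sum_nat_add fun n => ‖E ((T ^ n) x)‖ ^ 2
  refine h1.congr fun n => ?_
  rw [← (hasSum_norm_sq_observability E T h ((T ^ n) x)).tsum_eq]
  simp only [pow_add, mul_apply_eq_comp]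

theorem inner_pickOperator (T : X →L[ℂ] X) (E : X →L[ℂ] Y) (N : X →L[ℂ] U)
    (hE : OutputStable E T) (hN : OutputStable N T) (x : X) :
    ⟪pickOperator T E N hE hN x, x⟫_ℂ =
      ((‖observability E T hE x‖ ^ 2 - ‖observability N T hN x‖ ^ 2 : ℝ) : ℂ) := by
  simp only [pickOperator, sub_apply, ContinuousLinearMap.comp_apply,
    inner_sub_left, ContinuousLinearMap.adjoint_inner_left, inner_self_eq_norm_sq_to_K]
  push_cast
  rfl

end Observability

/-! ### The transfer function interpolates. -/

section Sufficiency

variable {X H U Y : Type*}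
  [NormedAddCommGroup X] [InnerProductSpace ℂ X] [CompleteSpace X]
  [NormedAddCommGroup H] [InnerProductSpace ℂ H]
  [NormedAddCommGroup U] [InnerProductSpace ℂ U]
  [NormedAddCommGroup Y] [InnerProductSpace ℂ Y] [CompleteSpace Y]
  {T : X →L[ℂ] X} {E : X →L[ℂ] Y} {N : X →L[ℂ] U} {Q : X →L[ℂ] H}
  {A : H →L[ℂ] H} {B : U →L[ℂ] H} {C : H →L[ℂ] Y} {D : U →L[ℂ] Y}

theorem IsContractiveColligation.hasSum_inner_markovParameter
    (hK : IsContractiveColligation A B C D) (hE : OutputStable E T)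
    (h₁ : ∀ h x, ⟪h, Q x⟫_ℂ = ⟪A h, Q (T x)⟫_ℂ + ⟪C h, E x⟫_ℂ)
    (h₂ : ∀ u x, ⟪u, N x⟫_ℂ = ⟪B u, Q (T x)⟫_ℂ + ⟪D u, E x⟫_ℂ)
    (hQ : ∀ x, ‖Q x‖ ≤ ‖observability E T hE x‖) (u : U) (x : X)
    (hs : Summable fun k => ⟪markovParameter A B C D k u, E ((T ^ k) x)⟫_ℂ) :
    HasSum (fun k => ⟪markovParameter A B C D k u, E ((T ^ k) x)⟫_ℂ) ⟪u, N x⟫_ℂ := by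
  -- Each use of `h₁`, at `A^n B u` and `T^(n+1) x`, splits the remainder into the next term of the
  -- sum and a new remainder.
  have hsum : ∀ n, ∑ k ∈ Finset.range (n + 1), ⟪markovParameter A B C D k u, E ((T ^ k) x)⟫_ℂ =
      ⟪u, N x⟫_ℂ - ⟪(A ^ n) (B u), Q ((T ^ (n + 1)) x)⟫_ℂ := by
    intro n
    induction n with
    | zero => simp [markovParameter, h₂]
    | succ n ih =>
      rw [Finset.sum_range_succ, ih, h₁ ((A ^ n) (B u)), pow_succ' A, pow_succ' T (n + 1)]
      simp only [markovParameter, ContinuousLinearMap.comp_apply, mul_apply_eq_comp]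
      ring
  have hQ0 : Tendsto (fun n => ‖Q ((T ^ n) x)‖) atTop (𝓝 0) := by
    have h := (tendsto_norm_sq_observability_pow E T hE x).sqrt
    simp only [Real.sqrt_sq (norm_nonneg _), Real.sqrt_zero] at h
    exact squeeze_zero (fun _ => norm_nonneg _) (fun _ => hQ _) h
  have hrem : Tendsto (fun n => ⟪(A ^ n) (B u), Q ((T ^ (n + 1)) x)⟫_ℂ) atTop (𝓝 0) := by
    refine squeeze_zero_norm (a := fun n => ‖u‖ * ‖Q ((T ^ (n + 1)) x)‖) (fun n => ?_) ?_
    · refine (norm_inner_le_norm _ _).trans ?_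
      gcongr
      exact hK.norm_pow_input_le u n
    · simpa using ((tendsto_add_atTop_iff_nat 1).2 hQ0).const_mul ‖u‖
  have hlim := (tendsto_const_nhds (x := ⟪u, N x⟫_ℂ)).sub hrem
  rw [sub_zero] at hlim
  have hlim' := (tendsto_add_atTop_iff_nat (f := fun n =>
    ∑ k ∈ Finset.range n, ⟪markovParameter A B C D k u, E ((T ^ k) x)⟫_ℂ) 1).1
    (hlim.congr fun n => (hsum n).symm)
  -- Telescoping only gives the limit of the ordered partial sums; `hs` upgrades it to unconditional
  -- summation.
  exact (tendsto_nhds_unique hs.hasSum.tendsto_sum_nat hlim') ▸ hs.hasSum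

variable [CompleteSpace H] [CompleteSpace U]

theorem IsContractiveColligation.isInterpolant
    (hK : IsContractiveColligation A B C D) (hE : OutputStable E T) (hN : OutputStable N T)
    (h₁ : ∀ h x, ⟪h, Q x⟫_ℂ = ⟪A h, Q (T x)⟫_ℂ + ⟪C h, E x⟫_ℂ)
    (h₂ : ∀ u x, ⟪u, N x⟫_ℂ = ⟪B u, Q (T x)⟫_ℂ + ⟪D u, E x⟫_ℂ)
    (hQ : ∀ x, ‖Q x‖ ≤ ‖observability E T hE x‖) :
    IsInterpolant T E N hE hN (transferFunction A B C D) := by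
  refine ⟨hK.isSchur_transferFunction, ?_⟩
  ext x n
  refine ext_inner_left ℂ fun u => ?_
  -- Pairing with `z^n u` reads off the `n`-th coefficient and moves `T_S^*` onto `z^n u`.
  refine (lp.inner_single_left (G := fun _ : ℕ => U) n u _).symm.trans ?_
  rw [observability_apply, ContinuousLinearMap.comp_apply,
    ContinuousLinearMap.adjoint_inner_right]
  have h := lp.hasSum_inner (𝕜 := ℂ)
    (toeplitz _ hK.isSchur_transferFunction (lp.single 2 n u)) (observability E T hE x)
  rw [← hasSum_nat_add_iff' n] at h
  have h0 : ∑ i ∈ Finset.range n,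
      ⟪toeplitz _ hK.isSchur_transferFunction (lp.single 2 n u) i, observability E T hE x i⟫_ℂ =
      0 :=
    Finset.sum_eq_zero fun i hi => by
      rw [hK.toeplitz_single, if_neg (by simpa using hi), inner_zero_left]
  rw [h0, sub_zero] at h
  simp only [hK.toeplitz_single, le_add_iff_nonneg_left, zero_le, if_true, add_tsub_cancel_right,
    observability_apply, pow_add, mul_apply_eq_comp] at h
  exact h.unique (hK.hasSum_inner_markovParameter hE h₁ h₂ hQ u _ h.summable)

end Sufficiency

/-! ### The interpolation criterion. -/

theorem theorem3p1 {X U Y : Type*}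
    [NormedAddCommGroup X] [InnerProductSpace ℂ X] [CompleteSpace X]
    [NormedAddCommGroup U] [InnerProductSpace ℂ U] [CompleteSpace U]
    [NormedAddCommGroup Y] [InnerProductSpace ℂ Y] [CompleteSpace Y]
    (T : X →L[ℂ] X) (E : X →L[ℂ] Y) (N : X →L[ℂ] U)
    (hE : OutputStable E T) (hN : OutputStable N T) :
    (∃ S : ℂ → U →L[ℂ] Y, IsInterpolant T E N hE hN S) ↔
      (pickOperator T E N hE hN).IsPositive := by
  constructor
  · rintro ⟨S, hS, hSN⟩
    rw [ContinuousLinearMap.isPositive_iff_complex]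
    intro x
    rw [inner_pickOperator]
    refine ⟨by rw [RCLike.re_to_complex, Complex.ofReal_re], ?_⟩
    rw [← hSN]
    have h1 : ‖ContinuousLinearMap.adjoint (toeplitz S hS) (observability E T hE x)‖ ≤
        ‖observability E T hE x‖ := by
      refine (ContinuousLinearMap.le_of_opNorm_le _ (c := 1) ?_ _).trans_eq (one_mul _)
      rw [ContinuousLinearMap.adjoint.norm_map]
      exact toeplitz_norm_le S hS
    have h2 := pow_le_pow_left₀ (norm_nonneg _) h1 2
    rw [RCLike.re_to_complex, Complex.ofReal_re, ContinuousLinearMap.comp_apply]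
    linarith
  · intro hP
    set P := pickOperator T E N hE hN with hPdef
    have hP0 : 0 ≤ P := (ContinuousLinearMap.nonneg_iff_isPositive P).2 hP
    set Q := CFC.sqrt P with hQdef
    have hQs : IsSelfAdjoint Q :=
      ((ContinuousLinearMap.nonneg_iff_isPositive Q).1 (CFC.sqrt_nonneg P)).isSelfAdjoint
    have hQQ : Q * Q = P := CFC.sqrt_mul_sqrt_self P hP0
    have hQn : ∀ x, ‖Q x‖ ^ 2 = ‖observability E T hE x‖ ^ 2 - ‖observability N T hN x‖ ^ 2 := by
      intro x
      have h1 := inner_pickOperator T E N hE hN x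
      rw [← hPdef, ← hQQ, mul_apply_eq_comp, ← ContinuousLinearMap.adjoint_inner_right,
        ContinuousLinearMap.isSelfAdjoint_iff'.1 hQs, inner_self_eq_norm_sq_to_K] at h1
      exact Complex.ofReal_injective (by simpa using h1)
    -- The state space is `X` itself; the isometry is `(QTx, Ex) ↦ (Qx, Nx)`.
    obtain ⟨A, B, C, D, hK, h₁, h₂⟩ := exists_isContractiveColligation (Q ∘L T) Q E N fun x => by
      rw [ContinuousLinearMap.comp_apply, hQn, hQn, norm_sq_observability_map,
        norm_sq_observability_map]
      ring
    refine ⟨transferFunction A B C D, hK.isInterpolant hE hN h₁ h₂ fun x => ?_⟩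
    refine (sq_le_sq₀ (norm_nonneg _) (norm_nonneg _)).1 ?_
    rw [hQn]
    linarith [sq_nonneg ‖observability N T hN x‖]
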